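/- Let $K$ be a field with $\operatorname{char}(K)\neq 2$, let $e_1,\dots,e_4$ be the standard basis of $K^4$, and let \[ \det\nolimits_4=\sum_{\sigma\in\mathfrak S_4}\operatorname{sgn}(\sigma)\,e_{\sigma(1)}\otimes e_{\sigma(2)}\otimes e_{\sigma(3)}\otimes e_{\sigma(4)}\in (K^4)^{\otimes 4} \] be the determinant tensor. For $T\in (K^4)^{\otimes 4}$, let the tensor rank $\mathbf R(T)$ be the smallest $k\ge 0$ such that $T=\sum_{i=1}^k v_{i,1}\otimes v_{i,2}\otimes v_{i,3}\otimes v_{i,4}$ for some vectors $v_{i,j}\in K^4$. Then \[ \mathbf R(\det\nolimits_4)=12 . \] -/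

import Mathlib

open scoped TensorProduct

/-- The tensor rank of `T ∈ ⨂ j, V j`: the least `k` such that `T` is a sum of `k` decomposable
tensors `v₁ ⊗ ⋯ ⊗ v_d`. -/
noncomputable def tensorRank {ι : Type*} (K : Type*) [Field K] {V : ι → Type*}
    [∀ j, AddCommGroup (V j)] [∀ j, Module K (V j)] (T : ⨂[K] j, V j) : ℕ :=
  sInf {k : ℕ | ∃ v : Fin k → (j : ι) → V j, T = ∑ i, PiTensorProduct.tprod K (v i)}

/-- The determinant tensor `∑ σ, sgn σ • e_{σ(1)} ⊗ ⋯ ⊗ e_{σ(n)}` in `(Kⁿ)^{⊗ n}`, where `e` is the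
standard basis of `Kⁿ`. -/
noncomputable def detTensor (K : Type*) [Field K] (n : ℕ) : ⨂[K] _ : Fin n, (Fin n → K) :=
  ∑ σ : Equiv.Perm (Fin n), ((Equiv.Perm.sign σ : ℤ) : K) •
    PiTensorProduct.tprod K (fun j : Fin n => (Pi.single (σ j) (1 : K) : Fin n → K))

/-!
Flatten a decomposition `∑ i, a i ⊗ b i ⊗ c i ⊗ d i` of `det₄` to a factorisation `M = P * Qᵀ` of a
matrix of rank `6 = dim ⋀² K⁴`, where column `i` of `P` is `a i ⊗ b i` and column `i` of `Q` is
`c i ⊗ d i`. Let `S` and `T` be the symmetrisations of `P` and `Q`. As `M` is skew in both pairs of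
indices, `S * Qᵀ = 0` and `P * Tᵀ = 0`, and the rank inequalities of Sylvester and Frobenius give
`rank M + rank S + rank T ≤ k` for a decomposition with `k` terms.

It remains to see that `S` and `T` have rank at least `3`. Let `W` be the antisymmetrisation of `P`.
Then `W * Qᵀ = 2 • M`, so the rows of `W` span a space of dimension at least `6` in the algebra
`Kᵏ`. Products of two rows of `W` are differences of products of two rows of `S`, because
`(a ∧ b)_{pq} (a ∧ b)_{rs}` is a `2 × 2` minor of the symmetric matrix of `a · b`. Squaring a
subspace of `Kᵏ` does not lower its dimension, and squaring a space of dimension `s` gives dimension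
at most `(s + 1).choose 2`; hence `6 ≤ (rank S + 1).choose 2`.

For the decomposition with twelve terms, expand `det₄` into the six products of complementary
`2 × 2` minors `w * w'`. If `σ`, `σ'` are the corresponding forms `eᵢ ⊗ eᵢ - eⱼ ⊗ eⱼ`, then
`2 * (w * w' + σ * σ') = (σ + w) * (σ' + w') + (σ - w) * (σ' - w')`, where `σ ± w` have rank one,
and the signed sum of the `σ * σ'` vanishes.
-/

open Matrix Module

section Rank

variable {K : Type*} [Field K]

theorem finrank_map_add_finrank_le {V W : Type*} [AddCommGroup V] [Module K V] [AddCommGroup W]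
    [Module K W] (f : V →ₗ[K] W) {S T : Submodule K V} [FiniteDimensional K T] (hST : S ≤ T) :
    finrank K (T.map f) + finrank K S ≤ finrank K T + finrank K (S.map f) := by
  have := Submodule.finiteDimensional_of_le hST
  have hS := (f.domRestrict S).finrank_range_add_finrank_ker
  have hT := (f.domRestrict T).finrank_range_add_finrank_ker
  rw [LinearMap.range_domRestrict] at hS hT
  have hker : finrank K (LinearMap.ker (f.domRestrict S)) ≤
      finrank K (LinearMap.ker (f.domRestrict T)) := by
    let j : LinearMap.ker (f.domRestrict S) →ₗ[K] LinearMap.ker (f.domRestrict T) :=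
      (Submodule.inclusion hST).restrict fun _ hx => hx
    refine LinearMap.finrank_le_finrank_of_injective (f := j) fun x y hxy => ?_
    exact Subtype.ext (Submodule.inclusion_injective hST (congrArg Subtype.val hxy))
  omega

theorem frobenius_rank_inequality {l m n o : Type*} [Fintype m] [Fintype n] [Fintype o]
    (A : Matrix l m K) (B : Matrix m n K) (C : Matrix n o K) :
    (A * B).rank + (B * C).rank ≤ B.rank + (A * B * C).rank := by
  have hle : LinearMap.range (B * C).mulVecLin ≤ LinearMap.range B.mulVecLin := by
    rw [mulVecLin_mul]
    exact LinearMap.range_comp_le_range _ _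
  have h := finrank_map_add_finrank_le A.mulVecLin hle
  rwa [← LinearMap.range_comp, ← LinearMap.range_comp, ← mulVecLin_mul, ← mulVecLin_mul,
    ← Matrix.mul_assoc] at h

end Rank

section PointwiseProducts

variable {K ι A : Type*} [Field K] [CommRing A] [Algebra K A]

theorem exists_map_funLeft_eq_top (U : Submodule K (ι → K)) [FiniteDimensional K U] :
    ∃ a : Fin (finrank K U) → ι, U.map (LinearMap.funLeft K K a) = ⊤ := by
  let f : Fin (finrank K U) → ι → K := fun k => finBasis K U k
  have hf : LinearIndependent K f :=
    (finBasis K U).linearIndependent.map' U.subtype U.ker_subtype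
  obtain ⟨κ, a, -, hspan, hli⟩ := exists_linearIndependent' K (flip f)
  rw [span_flip_eq_top_iff_linearIndependent.2 hf] at hspan
  let e := (Basis.mk hli hspan.ge).indexEquiv (Pi.basisFun K (Fin (finrank K U)))
  have hrow : Submodule.span K (Set.range fun k => f k ∘ a ∘ e.symm) = ⊤ :=
    span_flip_eq_top_iff_linearIndependent.2 (hli.comp e.symm e.symm.injective)
  refine ⟨a ∘ e.symm, top_unique (hrow.ge.trans (Submodule.span_le.2 ?_))⟩
  rintro _ ⟨k, rfl⟩
  exact ⟨f k, (finBasis K U k).2, rfl⟩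

theorem finrank_le_finrank_mul_self (U : Submodule K (ι → K)) [FiniteDimensional K U] :
    finrank K U ≤ finrank K ↥(U * U) := by
  obtain ⟨a, ha⟩ := exists_map_funLeft_eq_top U
  let ρ : (ι → K) →ₐ[K] (Fin (finrank K U) → K) :=
    AlgHom.pi fun k => Pi.evalAlgHom K _ (a k)
  have hU : U.map ρ.toLinearMap = ⊤ := ha
  have hUU : (U * U).map ρ.toLinearMap = ⊤ := by
    rw [Submodule.map_mul, hU, eq_top_iff]
    intro f _
    simpa using Submodule.mul_mem_mul (Submodule.mem_top (x := f)) (Submodule.mem_top (x := 1))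
  have hfg : U.FG := Module.Finite.iff_fg.1 ‹_›
  have : FiniteDimensional K ↥(U * U) := Module.Finite.iff_fg.2 (hfg.mul hfg)
  have h := Submodule.finrank_map_le ρ.toLinearMap (U * U)
  rwa [hUU, finrank_top, finrank_fin_fun] at h

theorem finrank_mul_self_le_choose (F : Submodule K A) [FiniteDimensional K F] :
    finrank K ↥(F * F) ≤ (finrank K F + 1).choose 2 := by
  obtain ⟨b, hb⟩ : ∃ b : Fin (finrank K F) → A, Submodule.span K (Set.range b) = F := by
    refine ⟨F.subtype ∘ finBasis K F, ?_⟩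
    rw [Set.range_comp, ← Submodule.map_span, Basis.span_eq, Submodule.map_subtype_top]
  let g : Sym2 (Fin (finrank K F)) → A := Sym2.lift ⟨fun i j => b i * b j, fun _ _ => mul_comm _ _⟩
  have hg : F * F ≤ Submodule.span K (Set.range g) := by
    have hFF : F * F = Submodule.span K (Set.range b) * Submodule.span K (Set.range b) := by
      rw [hb]
    rw [hFF, Submodule.span_mul_span, Submodule.span_le]
    rintro _ ⟨_, ⟨i, rfl⟩, _, ⟨j, rfl⟩, rfl⟩
    exact Submodule.subset_span ⟨s(i, j), rfl⟩
  have := FiniteDimensional.span_of_finite K (Set.finite_range g)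
  calc finrank K ↥(F * F) ≤ finrank K (Submodule.span K (Set.range g)) :=
        Submodule.finrank_mono hg
    _ ≤ Fintype.card (Sym2 (Fin (finrank K F))) := finrank_range_le_card g
    _ = (finrank K F + 1).choose 2 := by rw [Sym2.card, Fintype.card_fin]

end PointwiseProducts

/-- The Plücker coordinate of `x ∧ y` at the pair of indices `p`. -/
def plucker {R α : Type*} [CommRing R] (x y : α → R) (p : α × α) : R :=
  x p.1 * y p.2 - x p.2 * y p.1

theorem plucker_swap {R α : Type*} [CommRing R] (x y : α → R) (p : α × α) :
    plucker y x p = -plucker x y p := by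
  simp only [plucker]
  ring

section SkewTensors

variable {K ι α β n : Type*} [Field K]

/-- The matrix whose column `i` is the tensor `a i ⊗ b i`. -/
def prodMatrix (a b : ι → α → K) : Matrix (α × α) ι K :=
  of fun p i => a i p.1 * b i p.2

/-- The matrix whose column `i` is the symmetric tensor `a i ⊗ b i + b i ⊗ a i`. -/
def symMatrix (a b : ι → α → K) : Matrix (α × α) ι K :=
  of fun p i => a i p.1 * b i p.2 + a i p.2 * b i p.1

/-- The matrix whose column `i` is the bivector `a i ∧ b i`, as the tensor
`a i ⊗ b i - b i ⊗ a i`. -/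
def altMatrix (a b : ι → α → K) : Matrix (α × α) ι K :=
  of fun p i => plucker (a i) (b i) p

theorem symMatrix_eq_mul [Fintype α] [DecidableEq α] (a b : ι → α → K) :
    symMatrix a b = (1 + (1 : Matrix (α × α) (α × α) K).submatrix Prod.swap (Equiv.refl _)) *
      prodMatrix a b := by
  rw [Matrix.add_mul, Matrix.one_mul, one_submatrix_mul]
  rfl

theorem span_altMatrix_mul_self_le (a b : ι → α → K) :
    Submodule.span K (Set.range (altMatrix a b)) * Submodule.span K (Set.range (altMatrix a b)) ≤
      Submodule.span K (Set.range (symMatrix a b)) *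
        Submodule.span K (Set.range (symMatrix a b)) := by
  rw [Submodule.span_mul_span, Submodule.span_le]
  rintro _ ⟨_, ⟨p, rfl⟩, _, ⟨q, rfl⟩, rfl⟩
  have hmem (r s : α × α) : symMatrix a b r * symMatrix a b s ∈
      Submodule.span K (Set.range (symMatrix a b)) *
        Submodule.span K (Set.range (symMatrix a b)) :=
    Submodule.mul_mem_mul (Submodule.subset_span ⟨r, rfl⟩) (Submodule.subset_span ⟨s, rfl⟩)
  have hminor : altMatrix a b p * altMatrix a b q =
      symMatrix a b (p.1, q.2) * symMatrix a b (p.2, q.1) -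
        symMatrix a b (p.1, q.1) * symMatrix a b (p.2, q.2) := by
    funext i
    simp only [Pi.mul_apply, Pi.sub_apply, altMatrix, plucker, symMatrix, of_apply]
    ring
  simp only [hminor, SetLike.mem_coe]
  exact Submodule.sub_mem _ (hmem _ _) (hmem _ _)

variable [Fintype ι] {a b : ι → α → K} {c d : ι → β → K}

theorem rank_altMatrix_le_choose [Finite α] (a b : ι → α → K) :
    (altMatrix a b).rank ≤ ((symMatrix a b).rank + 1).choose 2 := by
  rw [rank_eq_finrank_span_row, rank_eq_finrank_span_row]
  calc finrank K (Submodule.span K (Set.range (altMatrix a b)))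
      ≤ _ := finrank_le_finrank_mul_self _
    _ ≤ _ := Submodule.finrank_mono (span_altMatrix_mul_self_le a b)
    _ ≤ _ := finrank_mul_self_le_choose _

theorem symMatrix_mul_eq_zero {B : Matrix ι n K} {M : Matrix (α × α) n K}
    (hM : prodMatrix a b * B = M) (hskew : M.submatrix Prod.swap id = -M) :
    symMatrix a b * B = 0 := by
  have hsplit : symMatrix a b * B = M + M.submatrix Prod.swap id := by
    rw [← hM]
    exact Matrix.add_mul (prodMatrix a b) ((prodMatrix a b).submatrix Prod.swap id) B
  rw [hsplit, hskew, add_neg_cancel]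

theorem altMatrix_mul_eq_two_smul {B : Matrix ι n K} {M : Matrix (α × α) n K}
    (hM : prodMatrix a b * B = M) (hskew : M.submatrix Prod.swap id = -M) :
    altMatrix a b * B = (2 : K) • M := by
  have hsplit : altMatrix a b * B = M - M.submatrix Prod.swap id := by
    rw [← hM]
    exact Matrix.sub_mul (prodMatrix a b) ((prodMatrix a b).submatrix Prod.swap id) B
  rw [hsplit, hskew, sub_neg_eq_add, two_smul]

theorem rank_le_choose_rank_symMatrix [Finite α] [Fintype n] (h2 : (2 : K) ≠ 0)
    {B : Matrix ι n K} {M : Matrix (α × α) n K} (hM : prodMatrix a b * B = M)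
    (hskew : M.submatrix Prod.swap id = -M) :
    M.rank ≤ ((symMatrix a b).rank + 1).choose 2 :=
  calc M.rank = ((2 : K) • M).rank :=
        (rank_smul_of_mem_nonZeroDivisors M (mem_nonZeroDivisors_of_ne_zero h2)).symm
    _ = (altMatrix a b * B).rank := by rw [altMatrix_mul_eq_two_smul hM hskew]
    _ ≤ (altMatrix a b).rank := rank_mul_le_left _ _
    _ ≤ ((symMatrix a b).rank + 1).choose 2 := rank_altMatrix_le_choose a b

variable [Finite α] [Fintype β] {M : Matrix (α × α) (β × β) K}

theorem rank_add_rank_symMatrix_add_rank_symMatrix_le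
    (hM : prodMatrix a b * (prodMatrix c d)ᵀ = M) (hrow : M.submatrix Prod.swap id = -M)
    (hcol : Mᵀ.submatrix Prod.swap id = -Mᵀ) :
    M.rank + (symMatrix a b).rank + (symMatrix c d).rank ≤ Fintype.card ι := by
  classical
  have hM' : prodMatrix c d * (prodMatrix a b)ᵀ = Mᵀ := by
    rw [← hM, transpose_mul, transpose_transpose]
  have hsylvester := rank_add_rank_le_card_of_mul_eq_zero (symMatrix_mul_eq_zero hM hrow)
  have hsym : (symMatrix c d)ᵀ = (prodMatrix c d)ᵀ *
      (1 + (1 : Matrix (β × β) (β × β) K).submatrix Prod.swap (Equiv.refl _))ᵀ := by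
    rw [symMatrix_eq_mul, transpose_mul]
  have hzero : prodMatrix a b * (symMatrix c d)ᵀ = 0 := by
    rw [← transpose_transpose (prodMatrix a b), ← transpose_mul, symMatrix_mul_eq_zero hM' hcol,
      transpose_zero]
  have hfrobenius := frobenius_rank_inequality (prodMatrix a b) (prodMatrix c d)ᵀ
    (1 + (1 : Matrix (β × β) (β × β) K).submatrix Prod.swap (Equiv.refl _))ᵀ
  rw [Matrix.mul_assoc, ← hsym, hzero, rank_zero, hM, rank_transpose (symMatrix c d)] at hfrobenius
  omega

theorem rank_add_two_mul_le_of_choose_lt (h2 : (2 : K) ≠ 0)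
    (hM : prodMatrix a b * (prodMatrix c d)ᵀ = M) (hrow : M.submatrix Prod.swap id = -M)
    (hcol : Mᵀ.submatrix Prod.swap id = -Mᵀ) {m : ℕ} (hm : m.choose 2 < M.rank) :
    M.rank + 2 * m ≤ Fintype.card ι := by
  have := Fintype.ofFinite α
  have hM' : prodMatrix c d * (prodMatrix a b)ᵀ = Mᵀ := by
    rw [← hM, transpose_mul, transpose_transpose]
  have hle {s : ℕ} (hs : M.rank ≤ (s + 1).choose 2) : m ≤ s := by
    by_contra! hlt
    exact (hm.trans_le hs).not_ge (Nat.choose_le_choose 2 hlt)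
  have hab := hle (rank_le_choose_rank_symMatrix h2 hM hrow)
  have hcd := hle (rank_transpose M ▸ rank_le_choose_rank_symMatrix h2 hM' hcol)
  have hsum := rank_add_rank_symMatrix_add_rank_symMatrix_le hM hrow hcol
  omega

end SkewTensors

section Contraction

variable {K ι α : Type*} [Field K] [Fintype ι] [Fintype α]

/-- The contraction of a tensor with the covectors `x j`, where `x j` acts on `α → K` by the dot
product. -/
noncomputable def contract (x : ι → α → K) : (⨂[K] _ : ι, (α → K)) →ₗ[K] K :=
  PiTensorProduct.dualDistrib (PiTensorProduct.tprod K fun j => (dotProductBilin K K).flip (x j))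

theorem contract_tprod (x v : ι → α → K) :
    contract x (PiTensorProduct.tprod K v) = ∏ j, v j ⬝ᵥ x j := by
  simp [contract, PiTensorProduct.dualDistrib_apply]

theorem contract_ext {S T : ⨂[K] _ : ι, (α → K)} (h : ∀ x, contract x S = contract x T) :
    S = T := by
  classical
  let e := Basis.piTensorProduct fun _ : ι => Pi.basisFun K α
  have hcoord (p : ι → α) :
      e.coord p = contract fun j => Pi.single (p j) 1 := by
    ext v
    simp [e, contract_tprod, Basis.piTensorProduct_repr_tprod_apply]
  refine e.ext_elem fun p => ?_
  rw [← e.coord_apply, ← e.coord_apply, hcoord, h]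

theorem contract_detTensor {n : ℕ} (x : Fin n → Fin n → K) :
    contract x (detTensor K n) = (of x).det := by
  simp [detTensor, contract_tprod, ← det_transpose (of x), det_apply']

theorem detTensor_eq_sum_tprod_iff {n k : ℕ} (v : Fin k → Fin n → Fin n → K) :
    detTensor K n = ∑ i, PiTensorProduct.tprod K (v i) ↔
      ∀ x : Fin n → Fin n → K, ∑ i, ∏ j, v i j ⬝ᵥ x j = (of x).det := by
  have hsum (x : Fin n → Fin n → K) :
      contract x (∑ i, PiTensorProduct.tprod K (v i)) = ∑ i, ∏ j, v i j ⬝ᵥ x j := by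
    simp only [map_sum, contract_tprod]
  refine ⟨fun h x => ?_, fun h => contract_ext fun x => ?_⟩
  · rw [← hsum, ← h, contract_detTensor]
  · rw [hsum, contract_detTensor, h]

end Contraction

/-- The two-element subsets of `Fin 4`, listed so that `pair r` and `pair r.rev` are
complementary. -/
def pair : Fin 6 → Fin 4 × Fin 4 := ![(0, 1), (0, 2), (0, 3), (1, 2), (1, 3), (2, 3)]

/-- The sign of the permutation of `Fin 4` that lists `pair r` followed by `pair r.rev`. -/
def pairSign (R : Type*) [CommRing R] : Fin 6 → R := ![1, -1, 1, 1, -1, 1]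

section Laplace

variable {R : Type*} [CommRing R]

theorem det_eq_sum_plucker_mul_plucker (x : Fin 4 → Fin 4 → R) :
    (of x).det = ∑ r, pairSign R r *
      (plucker (x 0) (x 1) (pair r) * plucker (x 2) (x 3) (pair r.rev)) := by
  rw [det_succ_row_zero]
  simp only [Fin.sum_univ_four, Fin.sum_univ_six, det_fin_three, submatrix_apply, of_apply,
    plucker, pair, pairSign, cons_val, Fin.reduceRev, Fin.reduceSucc, Fin.succAbove,
    Fin.reduceCastSucc, Fin.reduceLT, ↓reduceIte, Fin.coe_ofNat_eq_mod]
  ring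

theorem plucker_single_pair (r s : Fin 6) :
    plucker (Pi.single (pair r).1 1 : Fin 4 → R) (Pi.single (pair r).2 1) (pair s) =
      if r = s then 1 else 0 := by
  fin_cases r <;> fin_cases s <;> simp [plucker, pair]

/-- The value at `x ⊗ y` of the bilinear form `eᵢ ⊗ eᵢ - eⱼ ⊗ eⱼ`, where `p = (i, j)`; adding or
subtracting `plucker x y p` makes it a product of two linear forms. -/
def diagForm {α : Type*} (x y : α → R) (p : α × α) : R :=
  x p.1 * y p.1 - x p.2 * y p.2

theorem sum_diagForm_mul_diagForm (x y z w : Fin 4 → R) :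
    ∑ r, pairSign R r * (diagForm x y (pair r) * diagForm z w (pair r.rev)) = 0 := by
  simp only [Fin.sum_univ_six, diagForm, pair, pairSign, cons_val, Fin.reduceRev]
  ring

/-- The vector `eᵢ + ε eⱼ`, where `p = (i, j)`; its dot products are the linear factors of
`diagForm x y p + ε * plucker x y p`. -/
def pairVector {α : Type*} [DecidableEq α] (ε : R) (p : α × α) : α → R :=
  Pi.single p.1 1 + ε • Pi.single p.2 1

theorem pairVector_dotProduct_mul {α : Type*} [Fintype α] [DecidableEq α] {ε : R}
    (hε : ε * ε = 1) (p : α × α) (x y : α → R) :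
    (pairVector (-ε) p ⬝ᵥ x) * (pairVector ε p ⬝ᵥ y) = diagForm x y p + ε * plucker x y p := by
  simp only [pairVector, add_dotProduct, smul_dotProduct, single_one_dotProduct, smul_eq_mul,
    diagForm, plucker]
  linear_combination (-x p.2 * y p.2) * hε

end Laplace

section DetFour

variable {K : Type*} [Field K]

/-- The coordinates of `detTensor K 4`, flattened along the first two and the last two factors. -/
def detFlattening (K : Type*) [Field K] : Matrix (Fin 4 × Fin 4) (Fin 4 × Fin 4) K :=
  of fun p q => (of ![Pi.single p.1 1, Pi.single p.2 1, Pi.single q.1 1, Pi.single q.2 1]).det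

theorem detFlattening_apply (p q : Fin 4 × Fin 4) :
    detFlattening K p q = ∑ r, pairSign K r *
      (plucker (Pi.single p.1 1) (Pi.single p.2 1) (pair r) *
        plucker (Pi.single q.1 1) (Pi.single q.2 1) (pair r.rev)) :=
  det_eq_sum_plucker_mul_plucker _

theorem detFlattening_submatrix_swap :
    (detFlattening K).submatrix Prod.swap id = -detFlattening K := by
  ext p q
  simp only [submatrix_apply, Matrix.neg_apply, detFlattening_apply, Prod.fst_swap, Prod.snd_swap,
    id_eq, plucker_swap (Pi.single p.1 1 : Fin 4 → K), neg_mul, mul_neg, Finset.sum_neg_distrib]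

theorem detFlattening_transpose_submatrix_swap :
    (detFlattening K)ᵀ.submatrix Prod.swap id = -(detFlattening K)ᵀ := by
  ext q p
  simp only [submatrix_apply, transpose_apply, Matrix.neg_apply, detFlattening_apply, Prod.fst_swap,
    Prod.snd_swap, id_eq, plucker_swap (Pi.single q.1 1 : Fin 4 → K), mul_neg,
    Finset.sum_neg_distrib]

theorem detFlattening_submatrix_pair :
    (detFlattening K).submatrix pair (pair ∘ Fin.rev) = diagonal (pairSign K) := by
  ext r s
  simp only [submatrix_apply, Function.comp_apply, detFlattening_apply, plucker_single_pair,
    Fin.rev_inj, diagonal_apply]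
  obtain rfl | hrs := eq_or_ne r s <;> simp [*]

theorem six_le_rank_detFlattening : 6 ≤ (detFlattening K).rank := by
  classical
  have hsign (r : Fin 6) : pairSign K r ≠ 0 := by fin_cases r <;> simp [pairSign]
  calc 6 = (diagonal (pairSign K)).rank := by simp [rank_diagonal, hsign]
    _ = ((detFlattening K).submatrix pair (pair ∘ Fin.rev)).rank := by
        rw [detFlattening_submatrix_pair]
    _ ≤ (detFlattening K).rank := rank_submatrix_le _ _ _

theorem prodMatrix_mul_transpose_eq_detFlattening {k : ℕ} {v : Fin k → Fin 4 → Fin 4 → K}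
    (hv : detTensor K 4 = ∑ i, PiTensorProduct.tprod K (v i)) :
    prodMatrix (v · 0) (v · 1) * (prodMatrix (v · 2) (v · 3))ᵀ = detFlattening K := by
  ext p q
  rw [detFlattening, of_apply, ← (detTensor_eq_sum_tprod_iff v).1 hv]
  simp [Matrix.mul_apply, prodMatrix, Fin.prod_univ_four, mul_assoc]

theorem twelve_le_of_detTensor_eq_sum (h2 : (2 : K) ≠ 0) {k : ℕ} {v : Fin k → Fin 4 → Fin 4 → K}
    (hv : detTensor K 4 = ∑ i, PiTensorProduct.tprod K (v i)) : 12 ≤ k := by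
  have h6 : 6 ≤ (detFlattening K).rank := six_le_rank_detFlattening
  have h := rank_add_two_mul_le_of_choose_lt h2 (prodMatrix_mul_transpose_eq_detFlattening hv)
    detFlattening_submatrix_swap detFlattening_transpose_submatrix_swap
    (m := 3) (lt_of_lt_of_le (by decide) h6)
  rw [Fintype.card_fin] at h
  omega

theorem exists_detTensor_eq_sum_twelve (h2 : (2 : K) ≠ 0) :
    ∃ v : Fin 12 → Fin 4 → Fin 4 → K, detTensor K 4 = ∑ i, PiTensorProduct.tprod K (v i) := by
  let V (ε : K) (r : Fin 6) : Fin 4 → Fin 4 → K :=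
    ![(2⁻¹ * pairSign K r) • pairVector (-ε) (pair r), pairVector ε (pair r),
      pairVector (-ε) (pair r.rev), pairVector ε (pair r.rev)]
  have hV {ε : K} (hε : ε * ε = 1) (r : Fin 6) (x : Fin 4 → Fin 4 → K) :
      ∏ j, V ε r j ⬝ᵥ x j = 2⁻¹ * pairSign K r *
        ((diagForm (x 0) (x 1) (pair r) + ε * plucker (x 0) (x 1) (pair r)) *
          (diagForm (x 2) (x 3) (pair r.rev) + ε * plucker (x 2) (x 3) (pair r.rev))) := by
    rw [← pairVector_dotProduct_mul hε, ← pairVector_dotProduct_mul hε]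
    simp only [V, Fin.prod_univ_four, cons_val, smul_dotProduct, smul_eq_mul]
    ring
  refine ⟨Fin.append (V 1) (V (-1)), (detTensor_eq_sum_tprod_iff _).2 fun x => ?_⟩
  rw [Fin.sum_univ_add (a := 6) (b := 6)]
  simp only [Fin.append_left, Fin.append_right, hV (one_mul 1), hV (show (-1 : K) * -1 = 1 by ring)]
  rw [det_eq_sum_plucker_mul_plucker, eq_comm,
    ← add_zero (∑ r, _), ← sum_diagForm_mul_diagForm (x 0) (x 1) (x 2) (x 3),
    ← Finset.sum_add_distrib, ← Finset.sum_add_distrib]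
  refine Finset.sum_congr rfl fun r _ => ?_
  field_simp
  ring

end DetFour

theorem theorem4p4 (K : Type*) [Field K] (hK : ringChar K ≠ 2) :
    tensorRank K (detTensor K 4) = 12 := by
  have h2 : (2 : K) ≠ 0 := Ring.two_ne_zero hK
  have hupper := exists_detTensor_eq_sum_twelve h2
  refine le_antisymm (Nat.sInf_le hupper) (le_csInf ⟨12, hupper⟩ ?_)
  rintro k ⟨v, hv⟩
  exact twelve_le_of_detTensor_eq_sum h2 hv
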